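/- Let $d_1,\dots,d_n\ge 2$ be integers, $D=[d_1]\times\dots\times[d_n]$ and $E\subseteq D$. Let $\mathbb F$ be $\mathbb R$ or $\mathbb C$. A rank-one tensor over $\mathbb F$ is a tensor $\theta_1\otimes\dots\otimes\theta_n\in\mathbb F^D$ with $\theta_j\in\mathbb F^{d_j}$ (the zero tensor is allowed), that is, a tensor with entries $\prod_{j}\theta_{j,i_j}$. A partial tensor is an element $T_E\in\mathbb F^E$; a rank-one completion of $T_E$ over $\mathbb F$ is a rank-one tensor over $\mathbb F$ whose restriction to $E$ is $T_E$. Call $T_E$ uniquely completable over $\mathbb F$ if it has exactly one rank-one completion over $\mathbb F$, and finitely completable over $\mathbb F$ if it has at least one rank-one completion over $\mathbb F$ and each entry takes only finitely many values in the rank-one completions of $T_E$ over $\mathbb F$. Let $A_E$ be the integer matrix with columns $\sum_{j=1}^n e_{j,i_j}\in\mathbb Z^{d_1+\dots+d_n}$ for $(i_1,\dots,i_n)\in E$, and let $L_E\subseteq\mathbb Z^{d_1+\dots+d_n}$ be the lattice spanned by its columns. The saturation of $L_E$ is $\{x\in\mathbb Z^{d_1+\dots+d_n} : kx\in L_E\text{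 for some integer }k\neq 0\}$, and $L_E$ is saturated if it equals its saturation, i.e. if $kx\in L_E$ with an integer $k\neq 0$ implies $x\in L_E$. Then: (i) A partial tensor $T_E\in\mathbb C^E$ with nonzero entries is uniquely completable over $\mathbb C$ if and only if it is finitely completable over $\mathbb C$ and $L_E$ is saturated. (ii) A partial tensor $T_E\in\mathbb R^E$ with nonzero entries is uniquely completable over $\mathbb R$ if and only if it is finitely completable and the index of $L_E$ in its saturation is odd. Here the equivalence holds both when "finitely completable" is taken over $\mathbb R$ and when it is taken over $\mathbb C$. -/

import Mathlib

/-- The index set `D = [d₁] × ⋯ × [dₙ]` of the entries of a tensor. -/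
abbrev TensorIndex {n : ℕ} (d : Fin n → ℕ) : Type := (j : Fin n) → Fin (d j)

/-- The tensor product `θ₁ ⊗ ⋯ ⊗ θₙ` of vectors `θⱼ ∈ F ^ dⱼ`, in coordinates. -/
def vectorTensor {n : ℕ} {d : Fin n → ℕ} {F : Type*} [Field F]
    (θ : (j : Fin n) → Fin (d j) → F) : TensorIndex d → F :=
  fun i => ∏ j, θ j (i j)

/-- The rank-one tensors are the image of the parametrization map
`(θ₁, …, θₙ) ↦ θ₁ ⊗ ⋯ ⊗ θₙ`; in particular the zero tensor is allowed. -/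
def IsRankOneTensor {n : ℕ} {d : Fin n → ℕ} {F : Type*} [Field F]
    (S : TensorIndex d → F) : Prop :=
  ∃ θ : (j : Fin n) → Fin (d j) → F, vectorTensor θ = S

/-- The rank-one tensors over `F` whose restriction to `E` is the partial tensor `T`. -/
def rankOneCompletions {n : ℕ} {d : Fin n → ℕ} {F : Type*} [Field F]
    {E : Set (TensorIndex d)} (T : E → F) : Set (TensorIndex d → F) :=
  {S | IsRankOneTensor S ∧ ∀ e : E, S e = T e}

/-- The possible values of the entry at position `i` in a rank-one completion of `T`. -/
def completedEntryValues {n : ℕ} {d : Fin n → ℕ} {F : Type*} [Field F]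
    {E : Set (TensorIndex d)} (T : E → F) (i : TensorIndex d) : Set F :=
  {x | ∃ S ∈ rankOneCompletions T, S i = x}

/-- `T` has a rank-one completion over `F`, and every entry has only finitely many possible
values in such completions. -/
def FinitelyCompletable {n : ℕ} {d : Fin n → ℕ} {F : Type*} [Field F]
    {E : Set (TensorIndex d)} (T : E → F) : Prop :=
  (rankOneCompletions T).Nonempty ∧ ∀ i, (completedEntryValues T i).Finite

/-- `T` has exactly one rank-one completion over `F`. -/
def UniquelyCompletable {n : ℕ} {d : Fin n → ℕ} {F : Type*} [Field F]
    {E : Set (TensorIndex d)} (T : E → F) : Prop :=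
  ∃! S : TensorIndex d → F, S ∈ rankOneCompletions T

/-- The matrix `A` of the linear map `ℤ ^ D → ℤ ^ (d₁ + ⋯ + dₙ)`,
`e_{i₁,…,iₙ} ↦ ∑ⱼ e_{j,iⱼ}`. -/
def segreMatrix {n : ℕ} (d : Fin n → ℕ) : Matrix ((j : Fin n) × Fin (d j)) (TensorIndex d) ℤ :=
  Matrix.of fun r i => if i r.1 = r.2 then 1 else 0

/-- The matrix `A_E` consisting of the columns of `A` with indices in `E`. -/
def segreSubmatrix {n : ℕ} {d : Fin n → ℕ} (E : Set (TensorIndex d)) :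
    Matrix ((j : Fin n) × Fin (d j)) E ℤ :=
  (segreMatrix d).submatrix id Subtype.val

/-- The lattice spanned by the columns of `A_E`. -/
def columnLattice {n : ℕ} {d : Fin n → ℕ} (E : Set (TensorIndex d)) :
    AddSubgroup (((j : Fin n) × Fin (d j)) → ℤ) :=
  AddSubgroup.closure (Set.range (segreSubmatrix E).col)

/-- The saturation of a subgroup `L` of an abelian group: the elements that have a nonzero
integer multiple in `L`. -/
def latticeSaturation {M : Type*} [AddCommGroup M] (L : AddSubgroup M) : AddSubgroup M where
  carrier := {x | ∃ k : ℤ, k ≠ 0 ∧ k • x ∈ L}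
  zero_mem' := ⟨1, one_ne_zero, by simp⟩
  add_mem' := by
    rintro x y ⟨k, hk, hx⟩ ⟨l, hl, hy⟩
    refine ⟨k * l, mul_ne_zero hk hl, ?_⟩
    rw [smul_add]
    refine L.add_mem ?_ ?_
    · rw [mul_comm, mul_smul]
      exact L.zsmul_mem hx l
    · rw [mul_smul]
      exact L.zsmul_mem hy k
  neg_mem' := by
    rintro x ⟨k, hk, hx⟩
    exact ⟨k, hk, by rw [smul_neg]; exact L.neg_mem hx⟩

/-- The index of `L` in its saturation. -/
noncomputable def saturationIndex {M : Type*} [AddCommGroup M] (L : AddSubgroup M) : ℕ :=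
  L.relIndex (latticeSaturation L)

/-! Since the given entries are nonzero, a completion can be taken with nonzero factors `u`, and
entry `i` is then the character `x ↦ u^x` evaluated at the column of `i`. Multiplying `u` by a
character `v` trivial on `L_E` gives another completion, so uniqueness forces every such `v` to be
trivial on the lattice `L_D` of all columns. Let `L_D` be the column lattice for `E = D`. It is cut
out by equality of block sums, hence contains the saturation of `L_E`. Finite completability puts
all columns in that saturation (`FinitelyCompletable.segreColumn_mem_latticeSaturation`), so the two
coincide. Complex characters separate points from any sublattice, so over ℂ uniqueness means `L_D =
L_E`. On the torsion group `L_D / L_E` real characters only take the values ±1, so over ℝ it means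
odd index. For odd index a complex completion yields a real one by taking real roots
(`rankOneCompletions_real_nonempty`). -/

/-- The Laurent monomial with exponent vector `x`, evaluated at `u`. -/
def laurentMonomial {ι G : Type*} [Fintype ι] [CommGroup G] (u : ι → G) (x : ι → ℤ) : G :=
  ∏ r, u r ^ x r

section LaurentMonomial

variable {ι G : Type*} [Fintype ι] [CommGroup G]

theorem laurentMonomial_add (u : ι → G) (x y : ι → ℤ) :
    laurentMonomial u (x + y) = laurentMonomial u x * laurentMonomial u y := by
  simp [laurentMonomial, zpow_add, Finset.prod_mul_distrib]

/-- Evaluation of Laurent monomials at `u`, as a homomorphism in the exponent. -/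
def laurentMonomialHom (u : ι → G) : (ι → ℤ) →+ Additive G :=
  AddMonoidHom.mk' (fun x => Additive.ofMul (laurentMonomial u x)) fun x y => by
    rw [laurentMonomial_add, ofMul_mul]

theorem laurentMonomial_nsmul (u : ι → G) (k : ℕ) (x : ι → ℤ) :
    laurentMonomial u (k • x) = laurentMonomial u x ^ k :=
  Additive.ofMul.injective ((laurentMonomialHom u).map_nsmul k x)

theorem laurentMonomial_mul (u v : ι → G) (x : ι → ℤ) :
    laurentMonomial (u * v) x = laurentMonomial u x * laurentMonomial v x := by
  simp [laurentMonomial, mul_zpow, Finset.prod_mul_distrib]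

theorem laurentMonomial_zpow (g : G) (n x : ι → ℤ) :
    laurentMonomial (fun r => g ^ n r) x = g ^ ∑ r, n r * x r := by
  classical
  simp only [laurentMonomial, ← zpow_mul]
  exact (map_sum (zmultiplesHom (Additive G) (Additive.ofMul g)) _ _).symm

theorem laurentMonomial_eq_of_mem_closure {u v : ι → G} {s : Set (ι → ℤ)}
    (h : ∀ x ∈ s, laurentMonomial u x = laurentMonomial v x) {x : ι → ℤ}
    (hx : x ∈ AddSubgroup.closure s) : laurentMonomial u x = laurentMonomial v x :=
  AddMonoidHom.eqOn_closure (f := laurentMonomialHom u) (g := laurentMonomialHom v) h hx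

end LaurentMonomial

/-- The column of `segreMatrix d` with index `i`. -/
def segreColumn {n : ℕ} {d : Fin n → ℕ} (i : TensorIndex d) : ((j : Fin n) × Fin (d j)) → ℤ :=
  fun r => if i r.1 = r.2 then 1 else 0

theorem columnLattice_eq_closure_image {n : ℕ} {d : Fin n → ℕ} (E : Set (TensorIndex d)) :
    columnLattice E = AddSubgroup.closure (segreColumn '' E) := by
  rw [columnLattice, Set.image_eq_range]
  rfl

theorem segreColumn_mem_columnLattice {n : ℕ} {d : Fin n → ℕ} {E : Set (TensorIndex d)}
    {i : TensorIndex d} (hi : i ∈ E) : segreColumn i ∈ columnLattice E := by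
  rw [columnLattice_eq_closure_image]
  exact AddSubgroup.subset_closure (Set.mem_image_of_mem _ hi)

theorem laurentMonomial_segreColumn {n : ℕ} {d : Fin n → ℕ} {G : Type*} [CommGroup G]
    (u : ((j : Fin n) × Fin (d j)) → G) (i : TensorIndex d) :
    laurentMonomial u (segreColumn i) = ∏ j, u ⟨j, i j⟩ := by
  rw [laurentMonomial, Fintype.prod_sigma]
  refine Finset.prod_congr rfl fun j _ => ?_
  rw [Finset.prod_eq_single (i j)]
  · simp [segreColumn]
  · intro k _ hk
    simp [segreColumn, hk.symm]
  · simp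

/-- The rank-one tensor with nonzero factors `u`. -/
def unitTensor {n : ℕ} {d : Fin n → ℕ} {F : Type*} [Field F]
    (u : ((j : Fin n) × Fin (d j)) → Fˣ) : TensorIndex d → F :=
  vectorTensor fun j k => (u ⟨j, k⟩ : F)

theorem unitTensor_apply {n : ℕ} {d : Fin n → ℕ} {F : Type*} [Field F]
    (u : ((j : Fin n) × Fin (d j)) → Fˣ) (i : TensorIndex d) :
    unitTensor u i = (laurentMonomial u (segreColumn i) : Fˣ) := by
  rw [laurentMonomial_segreColumn, unitTensor, vectorTensor, Units.coe_prod]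

theorem isRankOneTensor_unitTensor {n : ℕ} {d : Fin n → ℕ} {F : Type*} [Field F]
    (u : ((j : Fin n) × Fin (d j)) → Fˣ) : IsRankOneTensor (unitTensor u) :=
  ⟨_, rfl⟩

/-! ### Completions and the saturation -/

section Completions

variable {n : ℕ} {d : Fin n → ℕ} {F : Type*} [Field F] {E : Set (TensorIndex d)} {T : E → F}

theorem exists_unitTensor_mem_rankOneCompletions (hT : ∀ e, T e ≠ 0)
    (h : (rankOneCompletions T).Nonempty) :
    ∃ u : ((j : Fin n) × Fin (d j)) → Fˣ, unitTensor u ∈ rankOneCompletions T := by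
  classical
  obtain ⟨_, ⟨θ, rfl⟩, hθ⟩ := h
  -- A zero factor coordinate is used by no entry in `E`, as `T` is nonzero there, so it may be
  -- replaced by 1.
  refine ⟨fun r => if h : θ r.1 r.2 = 0 then 1 else Units.mk0 _ h, isRankOneTensor_unitTensor _,
    fun e => ?_⟩
  have hprod : ∏ j, θ j (e.1 j) ≠ 0 := fun h => hT e ((hθ e).symm.trans h)
  rw [← hθ e, unitTensor, vectorTensor, vectorTensor]
  refine Finset.prod_congr rfl fun j _ => ?_
  have hne : θ j (e.1 j) ≠ 0 := Finset.prod_ne_zero_iff.mp hprod j (Finset.mem_univ j)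
  simp [hne]

theorem unitTensor_mul_mem_rankOneCompletions {u v : ((j : Fin n) × Fin (d j)) → Fˣ}
    (hu : unitTensor u ∈ rankOneCompletions T)
    (hv : ∀ x ∈ columnLattice E, laurentMonomial v x = 1) :
    unitTensor (u * v) ∈ rankOneCompletions T := by
  refine ⟨isRankOneTensor_unitTensor _, fun e => ?_⟩
  rw [unitTensor_apply, laurentMonomial_mul, hv _ (segreColumn_mem_columnLattice e.2), mul_one,
    ← unitTensor_apply, hu.2]

theorem laurentMonomial_eq_of_mem_rankOneCompletions {u v : ((j : Fin n) × Fin (d j)) → Fˣ}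
    (hu : unitTensor u ∈ rankOneCompletions T) (hv : unitTensor v ∈ rankOneCompletions T)
    {x : ((j : Fin n) × Fin (d j)) → ℤ} (hx : x ∈ columnLattice E) :
    laurentMonomial u x = laurentMonomial v x := by
  rw [columnLattice_eq_closure_image] at hx
  refine laurentMonomial_eq_of_mem_closure ?_ hx
  rintro _ ⟨i, hi, rfl⟩
  apply Units.ext
  rw [← unitTensor_apply, ← unitTensor_apply, hu.2 ⟨i, hi⟩, hv.2 ⟨i, hi⟩]

theorem exists_nsmul_mem_of_mem_latticeSaturation {M : Type*} [AddCommGroup M]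
    {L : AddSubgroup M} {x : M} (hx : x ∈ latticeSaturation L) :
    ∃ k : ℕ, k ≠ 0 ∧ k • x ∈ L := by
  obtain ⟨k, hk, h⟩ := hx
  refine ⟨k.natAbs, Int.natAbs_ne_zero.mpr hk, ?_⟩
  rw [← natCast_zsmul]
  rcases k.natAbs_eq with hk' | hk' <;> rw [hk'] at h
  · exact h
  · rwa [neg_smul, L.neg_mem_iff] at h

theorem le_latticeSaturation {M : Type*} [AddCommGroup M] (L : AddSubgroup M) :
    L ≤ latticeSaturation L := fun x hx => ⟨1, one_ne_zero, by simpa using hx⟩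

/-- If all columns lie in the saturation of the lattice of `E`, then `E` meets every slice. -/
theorem exists_mem_apply_eq (hE : ∀ i : TensorIndex d, segreColumn i ∈ latticeSaturation
    (columnLattice E)) (i : TensorIndex d) (j : Fin n) : ∃ e ∈ E, e j = i j := by
  by_contra! hne
  have hzero : ∀ x ∈ columnLattice E, x ⟨j, i j⟩ = 0 := by
    intro x hx
    rw [columnLattice_eq_closure_image] at hx
    refine (AddSubgroup.closure_le (Pi.evalAddMonoidHom (fun _ => ℤ)
      (⟨j, i j⟩ : (j : Fin n) × Fin (d j))).ker).mpr ?_ hx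
    rintro _ ⟨e, he, rfl⟩
    simp [AddMonoidHom.mem_ker, segreColumn, hne e he]
  obtain ⟨k, hk, hx⟩ := hE i
  have := hzero _ hx
  simp [segreColumn, hk] at this

theorem eq_unitTensor_of_mem_rankOneCompletions (hd : ∀ j, 0 < d j) (hT : ∀ e, T e ≠ 0)
    (hE : ∀ i : TensorIndex d, segreColumn i ∈ latticeSaturation (columnLattice E))
    {S : TensorIndex d → F} (hS : S ∈ rankOneCompletions T) :
    ∃ u : ((j : Fin n) × Fin (d j)) → Fˣ, unitTensor u = S := by
  obtain ⟨⟨θ, rfl⟩, hθ⟩ := hS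
  have hne : ∀ r : (j : Fin n) × Fin (d j), θ r.1 r.2 ≠ 0 := by
    rintro ⟨j, k⟩
    obtain ⟨e, he, hek⟩ := exists_mem_apply_eq hE (Function.update (fun j => ⟨0, hd j⟩) j k) j
    rw [Function.update_self] at hek
    have hprod : ∏ j, θ j (e j) ≠ 0 := fun h => hT ⟨e, he⟩ ((hθ ⟨e, he⟩).symm.trans h)
    rw [← hek]
    exact Finset.prod_ne_zero_iff.mp hprod j (Finset.mem_univ j)
  exact ⟨fun r => Units.mk0 _ (hne r), rfl⟩

theorem rankOneCompletions_apply_pow_eq (hd : ∀ j, 0 < d j) (hT : ∀ e, T e ≠ 0)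
    (hE : ∀ i : TensorIndex d, segreColumn i ∈ latticeSaturation (columnLattice E))
    {S S' : TensorIndex d → F} (hS : S ∈ rankOneCompletions T) (hS' : S' ∈ rankOneCompletions T)
    {i : TensorIndex d} {k : ℕ} (hk : k • segreColumn i ∈ columnLattice E) :
    S i ^ k = S' i ^ k := by
  obtain ⟨u, rfl⟩ := eq_unitTensor_of_mem_rankOneCompletions hd hT hE hS
  obtain ⟨v, rfl⟩ := eq_unitTensor_of_mem_rankOneCompletions hd hT hE hS'
  have := laurentMonomial_eq_of_mem_rankOneCompletions hS hS' hk
  rw [laurentMonomial_nsmul, laurentMonomial_nsmul] at this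
  simpa only [unitTensor_apply, Units.val_pow_eq_pow_val] using congrArg Units.val this

theorem finitelyCompletable_of_mem_latticeSaturation (hd : ∀ j, 0 < d j) (hT : ∀ e, T e ≠ 0)
    (hE : ∀ i : TensorIndex d, segreColumn i ∈ latticeSaturation (columnLattice E))
    (hne : (rankOneCompletions T).Nonempty) : FinitelyCompletable T := by
  classical
  refine ⟨hne, fun i => ?_⟩
  obtain ⟨S, hS⟩ := hne
  obtain ⟨k, hk0, hk⟩ := exists_nsmul_mem_of_mem_latticeSaturation (hE i)
  refine (Polynomial.nthRoots k (S i ^ k)).toFinset.finite_toSet.subset ?_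
  rintro _ ⟨S', hS', rfl⟩
  rw [Finset.mem_coe, Multiset.mem_toFinset, Polynomial.mem_nthRoots (Nat.pos_of_ne_zero hk0)]
  exact rankOneCompletions_apply_pow_eq hd hT hE hS' hS hk

theorem UniquelyCompletable.finitelyCompletable (h : UniquelyCompletable T) :
    FinitelyCompletable T := by
  obtain ⟨S, hS, huniq⟩ := h
  refine ⟨⟨S, hS⟩, fun i => (Set.finite_singleton (S i)).subset ?_⟩
  rintro _ ⟨S', hS', rfl⟩
  simp [huniq S' hS']

theorem UniquelyCompletable.laurentMonomial_segreColumn_eq_one (hT : ∀ e, T e ≠ 0)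
    (h : UniquelyCompletable T) {v : ((j : Fin n) × Fin (d j)) → Fˣ}
    (hv : ∀ x ∈ columnLattice E, laurentMonomial v x = 1) (i : TensorIndex d) :
    laurentMonomial v (segreColumn i) = 1 := by
  obtain ⟨u, hu⟩ := exists_unitTensor_mem_rankOneCompletions hT h.exists
  have := congrFun (h.unique (unitTensor_mul_mem_rankOneCompletions hu hv) hu) i
  rw [unitTensor_apply, unitTensor_apply, Units.val_inj, laurentMonomial_mul] at this
  exact mul_eq_left.mp this

/-- Otherwise a linear functional kills `L_E` but not the column, and the one-parameter subgroup it
defines moves entry `i` through infinitely many values. -/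
theorem FinitelyCompletable.segreColumn_mem_latticeSaturation [CharZero F] (hT : ∀ e, T e ≠ 0)
    (h : FinitelyCompletable T) (i : TensorIndex d) :
    segreColumn i ∈ latticeSaturation (columnLattice E) := by
  classical
  by_contra hi
  obtain ⟨u, hu⟩ := exists_unitTensor_mem_rankOneCompletions hT h.1
  obtain ⟨f, hf, hfi⟩ : ∃ f : (((j : Fin n) × Fin (d j)) → ℤ) →ₗ[ℤ] ℤ,
      (∀ x ∈ columnLattice E, f x = 0) ∧ f (segreColumn i) ≠ 0 := by
    set M := (latticeSaturation (columnLattice E)).toIntSubmodule with hM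
    -- The quotient by a saturated sublattice is torsion-free and finitely generated, hence free, so
    -- functionals separate its points.
    have htf : Module.IsTorsionFree ℤ ((((j : Fin n) × Fin (d j)) → ℤ) ⧸ M) := by
      refine .of_smul_eq_zero fun k x hx => ?_
      obtain ⟨x, rfl⟩ := M.mkQ_surjective x
      rw [← map_smul, Submodule.mkQ_apply, Submodule.Quotient.mk_eq_zero] at hx
      refine or_iff_not_imp_left.mpr fun hk => ?_
      obtain ⟨l, hl, hx⟩ := hx
      rw [Submodule.mkQ_apply, Submodule.Quotient.mk_eq_zero]
      exact ⟨l * k, mul_ne_zero hl hk, by rwa [mul_smul]⟩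
    have hne : M.mkQ (segreColumn i) ≠ 0 := by
      rwa [Ne, Submodule.mkQ_apply, Submodule.Quotient.mk_eq_zero]
    obtain ⟨f, hf⟩ := Module.Projective.exists_dual_ne_zero ℤ hne
    refine ⟨f ∘ₗ M.mkQ, fun x hx => ?_, hf⟩
    have : M.mkQ x = 0 :=
      (Submodule.Quotient.mk_eq_zero M).mpr (le_latticeSaturation _ hx)
    rw [LinearMap.comp_apply, this, map_zero]
  have hsum : ∀ x, ∑ r, f (Pi.single r 1) * x r = f x := fun x => by
    conv_rhs => rw [f.pi_apply_eq_sum_univ x]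
    refine Finset.sum_congr rfl fun r _ => ?_
    rw [smul_eq_mul, mul_comm]
    congr 2
    ext s
    simp [Pi.single_apply, eq_comm]
  -- The base 2 serves because it has infinite order in characteristic zero.
  let v : ℤ → ((j : Fin n) × Fin (d j)) → Fˣ := fun t r =>
    (Units.mk0 (2 : F) two_ne_zero ^ t) ^ f (Pi.single r 1)
  have hv : ∀ t x, laurentMonomial (v t) x = (Units.mk0 (2 : F) two_ne_zero ^ t) ^ f x :=
    fun t x => by rw [laurentMonomial_zpow, hsum]
  have hmem : ∀ t, unitTensor (u * v t) ∈ rankOneCompletions T := fun t =>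
    unitTensor_mul_mem_rankOneCompletions hu fun x hx => by rw [hv, hf x hx, zpow_zero]
  suffices hinj : Function.Injective fun t : ℤ => unitTensor (u * v t) i from
    Set.infinite_of_injective_forall_mem hinj
      (fun t => (⟨_, hmem t, rfl⟩ : _ ∈ completedEntryValues T i)) (h.2 i)
  intro s t hst
  simp only [unitTensor_apply, laurentMonomial_mul, hv, Units.val_inj, mul_right_inj,
    ← zpow_mul] at hst
  have h2 : Function.Injective fun k : ℤ => (2 : F) ^ k := by
    intro a b hab
    have : ((2 : ℚ) ^ a) = 2 ^ b := by
      apply (algebraMap ℚ F).injective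
      simpa using hab
    exact zpow_right_injective₀ (by norm_num) (by norm_num) this
  have := h2 (by simpa using congrArg Units.val hst)
  exact mul_right_cancel₀ hfi this

end Completions

/-! ### Saturation index and the lattice of all columns -/

theorem nsmul_saturationIndex_mem {M : Type*} [AddCommGroup M] {L : AddSubgroup M} {x : M}
    (hx : x ∈ latticeSaturation L) : saturationIndex L • x ∈ L :=
  L.nsmul_relIndex_mem hx

/-- If every element of the saturation of `L` is congruent modulo `L` to a double, then the index
of `L` in its saturation is odd. -/
theorem odd_saturationIndex {M : Type*} [AddCommGroup M] [Module.Finite ℤ M] (L : AddSubgroup M)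
    (h : ∀ x ∈ latticeSaturation L, ∃ y, x - 2 • y ∈ L) : Odd (saturationIndex L) := by
  let Q := latticeSaturation L ⧸ L.addSubgroupOf (latticeSaturation L)
  have hmk : ∀ x : latticeSaturation L, (x : Q) = 0 ↔ (x : M) ∈ L := fun x => by
    rw [QuotientAddGroup.eq_zero_iff, AddSubgroup.mem_addSubgroupOf]
  have : Module.Finite ℤ (latticeSaturation L) :=
    inferInstanceAs (Module.Finite ℤ (latticeSaturation L).toIntSubmodule)
  have hfg : AddGroup.FG Q :=
    have : AddGroup.FG (latticeSaturation L) := Module.Finite.iff_addGroup_fg.mp this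
    inferInstance
  -- Finiteness must be shown: an infinite index would count as 0, which is even.
  have : Finite Q := by
    refine AddCommGroup.finite_of_fg_isAddTorsion _ fun q => ?_
    obtain ⟨x, rfl⟩ := QuotientAddGroup.mk_surjective q
    obtain ⟨k, hk0, hk⟩ := exists_nsmul_mem_of_mem_latticeSaturation x.2
    refine isOfFinAddOrder_iff_nsmul_eq_zero.mpr ⟨k, Nat.pos_of_ne_zero hk0, ?_⟩
    rw [← QuotientAddGroup.mk_nsmul]
    exact (hmk _).mpr hk
  -- Doubling is onto, hence injective on a finite group, which excludes the element of order 2 that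
  -- Cauchy's theorem gives for even order.
  have hsurj : Function.Surjective fun q : Q => 2 • q := by
    intro q
    obtain ⟨x, rfl⟩ := QuotientAddGroup.mk_surjective q
    obtain ⟨y, hy⟩ := h x x.2
    have hy' : y ∈ latticeSaturation L := by
      have h2 : 2 • y ∈ latticeSaturation L := by
        simpa using (latticeSaturation L).sub_mem x.2 (le_latticeSaturation L hy)
      obtain ⟨k, hk, hk'⟩ := h2
      exact ⟨k * 2, by simpa using hk, by rwa [mul_smul, ofNat_zsmul]⟩
    refine ⟨((⟨y, hy'⟩ : latticeSaturation L) : Q), Eq.symm (sub_eq_zero.mp ?_)⟩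
    exact (hmk (x - 2 • ⟨y, hy'⟩)).mpr hy
  have hinj := Finite.injective_iff_surjective.mpr hsurj
  rw [← Nat.not_even_iff_odd, even_iff_two_dvd]
  intro hdvd
  have : Fact (Nat.Prime 2) := ⟨Nat.prime_two⟩
  obtain ⟨q, hq⟩ := exists_prime_addOrderOf_dvd_card' (G := Q) 2 hdvd
  have hq0 : q = 0 := hinj (show 2 • q = 2 • 0 by rw [smul_zero, ← hq, addOrderOf_nsmul_eq_zero])
  simp [hq0] at hq

theorem sum_block_eq_of_mem_columnLattice {n : ℕ} {d : Fin n → ℕ} {E : Set (TensorIndex d)}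
    {x : ((j : Fin n) × Fin (d j)) → ℤ} (hx : x ∈ columnLattice E) (j j' : Fin n) :
    ∑ k, x ⟨j, k⟩ = ∑ k, x ⟨j', k⟩ := by
  rw [columnLattice_eq_closure_image] at hx
  induction hx using AddSubgroup.closure_induction with
  | mem x hx =>
    obtain ⟨i, -, rfl⟩ := hx
    simp [segreColumn]
  | zero => simp
  | add x y _ _ hx hy => simp [Finset.sum_add_distrib, hx, hy]
  | neg x _ hx => simp [hx]

theorem mem_columnLattice_univ_of_sum_block_eq {n : ℕ} {d : Fin n → ℕ} (hd : ∀ j, 0 < d j)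
    {x : ((j : Fin n) × Fin (d j)) → ℤ}
    (hx : ∀ j j', ∑ k, x ⟨j, k⟩ = ∑ k, x ⟨j', k⟩) :
    x ∈ columnLattice (Set.univ : Set (TensorIndex d)) := by
  let i₀ : TensorIndex d := fun j => ⟨0, hd j⟩
  rcases isEmpty_or_nonempty (Fin n) with h | ⟨⟨j₀⟩⟩
  · rw [Subsingleton.elim x 0]
    exact zero_mem _
  -- The differences are `e_{j,k} - e_{j,0}`. They match all coordinates with `k ≠ 0`, and the
  -- common block sum fixes those with `k = 0`.
  have key : x = (∑ k, x ⟨j₀, k⟩) • segreColumn i₀ +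
      ∑ r, x r • (segreColumn (Function.update i₀ r.1 r.2) - segreColumn i₀) := by
    ext ⟨j, k⟩
    rw [Fintype.sum_sigma, Pi.add_apply, Finset.sum_apply, Finset.sum_eq_single j]
    · simp only [Finset.sum_apply, Pi.smul_apply, Pi.sub_apply, segreColumn, Function.update_self,
        smul_eq_mul, mul_sub, Finset.sum_sub_distrib, ← Finset.sum_mul]
      rw [hx j₀ j]
      simp
    · intro j' _ hj'
      simp [Finset.sum_apply, segreColumn, Function.update_of_ne hj'.symm]
    · simp
  rw [key]
  have hmem : ∀ i : TensorIndex d, segreColumn i ∈ columnLattice Set.univ := fun i =>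
    segreColumn_mem_columnLattice (Set.mem_univ i)
  exact add_mem (zsmul_mem (hmem _) _)
    (sum_mem fun r _ => zsmul_mem (sub_mem (hmem _) (hmem _)) _)

theorem latticeSaturation_columnLattice_le {n : ℕ} {d : Fin n → ℕ} (hd : ∀ j, 0 < d j)
    (E : Set (TensorIndex d)) :
    latticeSaturation (columnLattice E) ≤ columnLattice Set.univ := by
  rintro x ⟨k, hk, hx⟩
  refine mem_columnLattice_univ_of_sum_block_eq hd fun j j' => mul_left_cancel₀ hk ?_
  simpa [Finset.mul_sum] using sum_block_eq_of_mem_columnLattice hx j j'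

theorem columnLattice_univ_le {n : ℕ} {d : Fin n → ℕ}
    {L : AddSubgroup (((j : Fin n) × Fin (d j)) → ℤ)} (h : ∀ i, segreColumn i ∈ L) :
    columnLattice Set.univ ≤ L := by
  rw [columnLattice_eq_closure_image, AddSubgroup.closure_le]
  rintro _ ⟨i, -, rfl⟩
  exact h i

/-! ### Separating characters -/

/-- Rational characters separate the points of `ℤ ^ ι` from a subgroup. -/
theorem exists_rat_character {ι : Type*} [Fintype ι] {H : AddSubgroup (ι → ℤ)} {x : ι → ℤ}
    (hx : x ∉ H) : ∃ q : ι → ℚ, (∀ y ∈ H, ∃ m : ℤ, ∑ r, q r * y r = m) ∧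
      ¬ ∃ m : ℤ, ∑ r, q r * x r = m := by
  classical
  have hne : (x : (ι → ℤ) ⧸ H) ≠ 0 := by rwa [Ne, QuotientAddGroup.eq_zero_iff]
  obtain ⟨c, hc⟩ := CharacterModule.exists_character_apply_ne_zero_of_ne_zero hne
  -- A ℚ/ℤ-valued character of the quotient by `H`, pulled back to `ℤ ^ ι`; `q` lifts its values on
  -- the basis.
  let f : (ι → ℤ) →+ AddCircle (1 : ℚ) := AddMonoidHom.comp c (QuotientAddGroup.mk' H)
  have hq : ∀ r, ∃ q : ℚ, (q : AddCircle (1 : ℚ)) = f (Pi.single r 1) := fun r =>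
    QuotientAddGroup.mk_surjective _
  choose q hq using hq
  have hf : ∀ y, f y = ((∑ r, q r * y r : ℚ) : AddCircle (1 : ℚ)) := fun y => by
    conv_lhs => rw [← Finset.univ_sum_single y]
    rw [map_sum]
    refine Eq.trans (Finset.sum_congr rfl fun r _ => ?_)
      (map_sum (QuotientAddGroup.mk' (AddSubgroup.zmultiples (1 : ℚ))) _ _).symm
    rw [show Pi.single r (y r) = y r • (Pi.single r 1 : ι → ℤ) by
      rw [← Pi.single_smul, smul_eq_mul, mul_one], map_zsmul, ← hq, mul_comm, ← zsmul_eq_mul]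
    rfl
  have hf0 : ∀ y, f y = 0 ↔ ∃ m : ℤ, ∑ r, q r * y r = m := fun y => by
    rw [hf, AddCircle.coe_eq_zero_iff]
    simp [eq_comm]
  refine ⟨q, fun y hy => (hf0 y).mp ?_, fun h => hc ((hf0 x).mpr h)⟩
  change c (y : (ι → ℤ) ⧸ H) = 0
  rw [(QuotientAddGroup.eq_zero_iff y).mpr hy, map_zero]

theorem exists_complex_character {ι : Type*} [Fintype ι] {H : AddSubgroup (ι → ℤ)} {x : ι → ℤ}
    (hx : x ∉ H) : ∃ v : ι → ℂˣ, (∀ y ∈ H, laurentMonomial v y = 1) ∧ laurentMonomial v x ≠ 1 := by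
  obtain ⟨q, hq, hqx⟩ := exists_rat_character hx
  let v : ι → ℂˣ := fun r =>
    Units.mk0 (Complex.exp (q r * (2 * Real.pi * Complex.I))) (Complex.exp_ne_zero _)
  have hv : ∀ y, laurentMonomial v y = 1 ↔ ∃ m : ℤ, ∑ r, q r * y r = m := fun y => by
    have : ((laurentMonomial v y : ℂˣ) : ℂ) =
        Complex.exp ((∑ r, q r * y r : ℚ) * (2 * Real.pi * Complex.I)) := by
      simp only [laurentMonomial, Units.coe_prod, Units.val_zpow_eq_zpow_val, v, Units.val_mk0,
        ← Complex.exp_int_mul, ← Complex.exp_sum]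
      push_cast
      rw [Finset.sum_mul]
      congr 1
      exact Finset.sum_congr rfl fun r _ => by ring
    rw [← Units.val_inj, this, Units.val_one, Complex.exp_eq_one_iff]
    refine exists_congr fun m => ?_
    rw [mul_left_inj' Complex.two_pi_I_ne_zero]
    exact_mod_cast Iff.rfl
  exact ⟨v, fun y hy => (hv y).mpr (hq y hy), fun h => hqx ((hv x).mp h)⟩

theorem exists_sign_character {ι : Type*} [Fintype ι] {L : AddSubgroup (ι → ℤ)} {x : ι → ℤ}
    (hx : ∀ y, x - 2 • y ∉ L) :
    ∃ v : ι → ℝˣ, (∀ y ∈ L, laurentMonomial v y = 1) ∧ laurentMonomial v x ≠ 1 := by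
  classical
  -- Adding all doubles to `L` forces the rational character into `½ℤ/ℤ`, which becomes ±1.
  let H : AddSubgroup (ι → ℤ) := L ⊔ (nsmulAddMonoidHom 2 : (ι → ℤ) →+ (ι → ℤ)).range
  have hxH : x ∉ H := by
    intro h
    obtain ⟨l, hl, _, ⟨y, rfl⟩, rfl⟩ := AddSubgroup.mem_sup.mp h
    exact hx y (by simpa using hl)
  obtain ⟨q, hq, hqx⟩ := exists_rat_character hxH
  have hn : ∀ r, ∃ m : ℤ, q r = m / 2 := fun r => by
    obtain ⟨m, hm⟩ := hq (2 • Pi.single r 1) (AddSubgroup.mem_sup_right ⟨_, rfl⟩)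
    refine ⟨m, ?_⟩
    rw [← hm, Finset.sum_eq_single r]
    · simp
    · intro s _ hs
      simp [hs]
    · simp
  choose m hm using hn
  have hv : ∀ y, laurentMonomial (fun r => (-1 : ℝˣ) ^ m r) y = 1 ↔
      ∃ k : ℤ, ∑ r, q r * y r = k := fun y => by
    have hsum : ∑ r, q r * y r = ((∑ r, m r * y r : ℤ) : ℚ) / 2 := by
      push_cast
      rw [Finset.sum_div]
      exact Finset.sum_congr rfl fun r _ => by rw [hm]; ring
    have hsign : ∀ z : ℤ, ((-1 : ℝˣ) ^ z = 1) ↔ Even z := fun z => by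
      rw [← Units.val_inj]
      push_cast
      rcases z.even_or_odd with hz | hz
      · simp [hz, hz.neg_one_zpow]
      · simp only [hz.neg_one_zpow, Int.not_even_iff_odd.mpr hz, iff_false]
        norm_num
    rw [laurentMonomial_zpow, hsum, hsign]
    refine exists_congr fun k => ?_
    rw [div_eq_iff two_ne_zero, ← mul_two]
    exact_mod_cast Iff.rfl
  exact ⟨_, fun y hy => (hv y).mpr (hq y (AddSubgroup.mem_sup_left hy)), fun h => hqx ((hv x).mp h)⟩

/-! ### Descent from complex to real completions -/

theorem exists_pow_eq_of_odd {m : ℕ} (hm : Odd m) (x : ℝ) : ∃ y, y ^ m = x := by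
  have hm0 : m ≠ 0 := hm.pos.ne'
  rcases le_total 0 x with hx | hx
  · exact ⟨x ^ (m⁻¹ : ℝ), Real.rpow_inv_natCast_pow hx hm0⟩
  · refine ⟨-(-x) ^ (m⁻¹ : ℝ), ?_⟩
    rw [hm.neg_pow, Real.rpow_inv_natCast_pow (neg_nonneg.mpr hx) hm0, neg_neg]

theorem isRankOneTensor_mul_prod {n : ℕ} {d : Fin n → ℕ} {F : Type*} [Field F] [NeZero n]
    (c : F) (w : (j : Fin n) → Fin (d j) → F) :
    IsRankOneTensor fun i : TensorIndex d => c * ∏ j, w j (i j) :=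
  ⟨fun j k => (if j = 0 then c else 1) * w j k, by
    ext i
    simp only [vectorTensor, Finset.prod_mul_distrib]
    simp⟩

/-- This multiplicative formula in the entries alone survives taking real `m`-th roots, with no need
to choose roots of the factors. -/
theorem unitTensor_eq_mul_prod {n : ℕ} {d : Fin n → ℕ} {F : Type*} [Field F]
    (u : ((j : Fin n) × Fin (d j)) → Fˣ) (i₀ i : TensorIndex d) :
    unitTensor u i = unitTensor u i₀ *
      ∏ j, unitTensor u (Function.update i₀ j (i j)) / unitTensor u i₀ := by
  have h : ∀ j, unitTensor u (Function.update i₀ j (i j)) / unitTensor u i₀ =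
      (u ⟨j, i j⟩ : F) / u ⟨j, i₀ j⟩ := fun j => by
    simp only [unitTensor, vectorTensor]
    rw [← Finset.prod_div_distrib, Finset.prod_eq_single j]
    · simp
    · intro k _ hk
      simp [Function.update_of_ne hk]
    · simp
  simp only [h, Finset.prod_div_distrib]
  rw [unitTensor, vectorTensor, vectorTensor, mul_div_cancel₀]
  exact Finset.prod_ne_zero_iff.mpr fun j _ => Units.ne_zero _

/-- A real partial tensor with a complex rank-one completion has a real one if the lattice of `E`
has odd index in its saturation and the latter contains all columns. -/
theorem rankOneCompletions_real_nonempty {n : ℕ} {d : Fin n → ℕ} (hd : ∀ j, 0 < d j)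
    {E : Set (TensorIndex d)} {T : E → ℝ} (hT : ∀ e, T e ≠ 0)
    (hE : ∀ i : TensorIndex d, segreColumn i ∈ latticeSaturation (columnLattice E))
    (hodd : Odd (saturationIndex (columnLattice E)))
    (h : (rankOneCompletions fun e => (T e : ℂ)).Nonempty) : (rankOneCompletions T).Nonempty := by
  obtain ⟨u, hu⟩ := exists_unitTensor_mem_rankOneCompletions
    (fun e => Complex.ofReal_ne_zero.mpr (hT e)) h
  set m := saturationIndex (columnLattice E)
  let v : ((j : Fin n) × Fin (d j)) → ℂˣ := fun r => Units.map (starRingEnd ℂ : ℂ →* ℂ) (u r)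
  have hconj : ∀ i, unitTensor v i = starRingEnd ℂ (unitTensor u i) := fun i => by
    simp only [unitTensor, vectorTensor, map_prod]
    rfl
  have hv : unitTensor v ∈ rankOneCompletions fun e => (T e : ℂ) :=
    ⟨isRankOneTensor_unitTensor v, fun e => by rw [hconj, hu.2, Complex.conj_ofReal]⟩
  -- The conjugate tensor also completes `T`, and `m`-th powers of entries agree across completions,
  -- so they are real.
  have hreal : ∀ i, ∃ σ : ℝ, (σ : ℂ) ^ m = unitTensor u i ^ m := fun i => by
    have hpow := rankOneCompletions_apply_pow_eq hd
      (fun e => Complex.ofReal_ne_zero.mpr (hT e)) hE hv hu (nsmul_saturationIndex_mem (hE i))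
    rw [hconj, ← map_pow] at hpow
    obtain ⟨ρ, hρ⟩ := Complex.conj_eq_iff_real.mp hpow
    obtain ⟨σ, hσ⟩ := exists_pow_eq_of_odd hodd ρ
    exact ⟨σ, by rw [hρ, ← hσ, Complex.ofReal_pow]⟩
  choose σ hσ using hreal
  have hinj : ∀ {a b : ℝ}, (a : ℂ) ^ m = (b : ℂ) ^ m → a = b := fun hab =>
    hodd.pow_injective (by exact_mod_cast hab)
  refine ⟨σ, ?_, fun e => hinj (by rw [hσ, hu.2])⟩
  rcases Nat.eq_zero_or_pos n with rfl | hn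
  · refine ⟨fun j => j.elim0, funext fun i => hinj ?_⟩
    rw [hσ]
    simp [unitTensor, vectorTensor]
  · have : NeZero n := ⟨hn.ne'⟩
    let i₀ : TensorIndex d := fun j => ⟨0, hd j⟩
    convert! isRankOneTensor_mul_prod (σ i₀) fun j k => σ (Function.update i₀ j k) / σ i₀ with i
    apply hinj
    push_cast
    simp only [mul_pow, ← Finset.prod_pow, div_pow, hσ]
    conv_lhs => rw [unitTensor_eq_mul_prod u i₀ i]
    simp only [mul_pow, ← Finset.prod_pow, div_pow]

/-! ### The equivalences -/

theorem UniquelyCompletable.segreColumn_mem_columnLattice {n : ℕ} {d : Fin n → ℕ}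
    {E : Set (TensorIndex d)} {T : E → ℂ} (hT : ∀ e, T e ≠ 0) (h : UniquelyCompletable T)
    (i : TensorIndex d) : segreColumn i ∈ columnLattice E := by
  by_contra hi
  obtain ⟨v, hv, hvi⟩ := exists_complex_character hi
  exact hvi (h.laurentMonomial_segreColumn_eq_one hT hv i)

theorem UniquelyCompletable.odd_saturationIndex {n : ℕ} {d : Fin n → ℕ} (hd : ∀ j, 0 < d j)
    {E : Set (TensorIndex d)} {T : E → ℝ} (hT : ∀ e, T e ≠ 0) (h : UniquelyCompletable T) :
    Odd (saturationIndex (columnLattice E)) := by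
  refine _root_.odd_saturationIndex _ fun x hx => ?_
  -- A saturation element not congruent to a double gives a sign character trivial on `L_E` but not
  -- on `L_D`, contradicting uniqueness.
  by_contra! hne
  obtain ⟨v, hv, hvx⟩ := exists_sign_character hne
  have hle : columnLattice Set.univ ≤ (laurentMonomialHom v).ker :=
    columnLattice_univ_le (h.laurentMonomial_segreColumn_eq_one hT hv)
  exact hvx (hle (latticeSaturation_columnLattice_le hd E hx))

theorem uniquelyCompletable_complex_iff {n : ℕ} {d : Fin n → ℕ} (hd : ∀ j, 0 < d j)
    {E : Set (TensorIndex d)} {T : E → ℂ} (hT : ∀ e, T e ≠ 0) :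
    UniquelyCompletable T ↔
      FinitelyCompletable T ∧ (columnLattice E).toAddSubmonoid.NSMulSaturated := by
  constructor
  · refine fun h => ⟨h.finitelyCompletable, fun k x hx => or_iff_not_imp_left.mpr fun hk => ?_⟩
    have hx' : x ∈ latticeSaturation (columnLattice E) :=
      ⟨k, Int.natCast_ne_zero.mpr hk, by rwa [natCast_zsmul]⟩
    exact columnLattice_univ_le (h.segreColumn_mem_columnLattice hT)
      (latticeSaturation_columnLattice_le hd E hx')
  · rintro ⟨hfin, hsat⟩
    have hE := hfin.segreColumn_mem_latticeSaturation hT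
    have hmem : ∀ i : TensorIndex d, segreColumn i ∈ columnLattice E := fun i => by
      obtain ⟨k, hk0, hk⟩ := exists_nsmul_mem_of_mem_latticeSaturation (hE i)
      exact (hsat hk).resolve_left hk0
    obtain ⟨S, hS⟩ := hfin.1
    refine ⟨S, hS, fun S' hS' => funext fun i => ?_⟩
    simpa using rankOneCompletions_apply_pow_eq hd hT hE hS' hS (k := 1) (i := i)
      (by simpa using hmem i)

theorem uniquelyCompletable_real_of_odd {n : ℕ} {d : Fin n → ℕ} (hd : ∀ j, 0 < d j)
    {E : Set (TensorIndex d)} {T : E → ℝ} (hT : ∀ e, T e ≠ 0)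
    (hE : ∀ i : TensorIndex d, segreColumn i ∈ latticeSaturation (columnLattice E))
    (hodd : Odd (saturationIndex (columnLattice E))) (hne : (rankOneCompletions T).Nonempty) :
    UniquelyCompletable T := by
  obtain ⟨S, hS⟩ := hne
  refine ⟨S, hS, fun S' hS' => funext fun i => hodd.pow_injective ?_⟩
  exact rankOneCompletions_apply_pow_eq hd hT hE hS' hS (nsmul_saturationIndex_mem (hE i))

theorem rankOneCompletions_ofReal_nonempty {n : ℕ} {d : Fin n → ℕ} {E : Set (TensorIndex d)}
    {T : E → ℝ} (h : (rankOneCompletions T).Nonempty) :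
    (rankOneCompletions fun e => (T e : ℂ)).Nonempty := by
  obtain ⟨_, ⟨θ, rfl⟩, hθ⟩ := h
  refine ⟨_, ⟨fun j k => (θ j k : ℂ), rfl⟩, fun e => ?_⟩
  simp [← hθ e, vectorTensor]

theorem mainTheorem6 {n : ℕ} (d : Fin n → ℕ) (hd : ∀ j, 2 ≤ d j) (E : Set (TensorIndex d)) :
    (∀ T : E → ℂ, (∀ e, T e ≠ 0) →
      (UniquelyCompletable T ↔
        FinitelyCompletable T ∧ (columnLattice E).toAddSubmonoid.NSMulSaturated)) ∧
    (∀ T : E → ℝ, (∀ e, T e ≠ 0) →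
      (UniquelyCompletable T ↔
        FinitelyCompletable T ∧ Odd (saturationIndex (columnLattice E))) ∧
      (UniquelyCompletable T ↔
        FinitelyCompletable (fun e => (T e : ℂ)) ∧
          Odd (saturationIndex (columnLattice E)))) := by
  have hd' : ∀ j, 0 < d j := fun j => two_pos.trans_le (hd j)
  refine ⟨fun T hT => uniquelyCompletable_complex_iff hd' hT, fun T hT => ?_⟩
  have hTC : ∀ e, (T e : ℂ) ≠ 0 := fun e => Complex.ofReal_ne_zero.mpr (hT e)
  refine ⟨⟨fun h => ⟨h.finitelyCompletable, h.odd_saturationIndex hd' hT⟩, fun h => ?_⟩,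
    fun h => ⟨?_, h.odd_saturationIndex hd' hT⟩, fun h => ?_⟩
  · exact uniquelyCompletable_real_of_odd hd' hT (h.1.segreColumn_mem_latticeSaturation hT) h.2
      h.1.1
  · exact finitelyCompletable_of_mem_latticeSaturation hd' hTC
      (h.finitelyCompletable.segreColumn_mem_latticeSaturation hT)
      (rankOneCompletions_ofReal_nonempty h.finitelyCompletable.1)
  · have hE := h.1.segreColumn_mem_latticeSaturation hTC
    exact uniquelyCompletable_real_of_odd hd' hT hE h.2
      (rankOneCompletions_real_nonempty hd' hT hE h.2 h.1.1)
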